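/- Let $K$ be a field of characteristic different from $2$ and let $X$ be a connected partially ordered set (any two elements are joined by a finite sequence in which consecutive elements are comparable). Let $I(X,K)$ be the space of functions $f:X\times X\to K$ with $f(x,y)=0$ whenever $x\not\le y$, and let $FI(X,K)$ be the finitary incidence algebra, that is, the set of those $f\in I(X,K)$ such that for all $x\le y$ in $X$ only finitely many subintervals $[u,v]\subseteq[x,y]$ with $u\ne v$ satisfy $f(u,v)\neq 0$, with the product $(fg)(x,y)=\sum_{x\le z\le y}f(x,z)g(z,y)$. For $x\in X$ let $e_x\in FI(X,K)$ be the function with value $1$ at $(x,x)$ and $0$ elsewhere. Assume that every multiplicative automorphism of $FI(X,K)$ is inner: for every $\sigma\in I(X,K)$ with $\sigma(x,y)\ne0$ for $x\le y$ and $\sigma(x,y)\sigma(y,z)=\sigma(x,z)$ for $x\le y\le z$, the automorphism $M_\sigma(f)(x,y)=\sigma(x,y)f(x,y)$ has the form $\Psi_u(a)=uau^{-1}$ for some invertible $u\in FI(X,K)$. An involution on a $K$-algebra $A$ is an additive (not necessarily $K$-linear) map $\rho:A\to A$ with $\rho(ab)=\rho(b)\rho(a)$ and $\rho^2=\mathrm{id}$;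 it is of the second kind if it is not the identity on the center of $A$. An involution on $X$ is a map $\lambda:X\to X$ with $\lambda^2=\mathrm{id}$ and $x\le y\Leftrightarrow\lambda(y)\le\lambda(x)$. Let $*$ be an involution of the second kind on $K$, and let $\lambda$ be an involution on $X$ such that $\lambda(x)=x$ for exactly one $x\in X$. Let $\rho_\lambda^*$ be the involution on $FI(X,K)$ given by $\rho_\lambda^*(f)(x,y)=[f(\lambda(y),\lambda(x))]^*$. Let $\rho$ be any involution on $FI(X,K)$ that induces $\lambda$ on $X$ (for each $x\in X$, $\rho(e_x)$ is conjugate to $e_{\lambda(x)}$ by an invertible element of $FI(X,K)$) and $*$ on $K$ ($\rho(a\cdot 1)=a^*\cdot 1$ for all $a\in K$). Then $\rho$ is equivalent to $\rho_\lambda^*$ via an inner automorphism: there is an invertible $u\in FI(X,K)$ with $\Psi_u\circ\rho=\rho_\lambda^*\circ\Psi_u$. -/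

import Mathlib

/-- A map `ρ : A → A` is an involution on the ring `A` if it is additive, reverses products and
satisfies `ρ (ρ a) = a`. No linearity over a base field is required. -/
structure IsAlgInvolution {A : Type*} [Ring A] (ρ : A → A) : Prop where
  map_add : ∀ a b, ρ (a + b) = ρ a + ρ b
  map_mul : ∀ a b, ρ (a * b) = ρ b * ρ a
  involutive : ∀ a, ρ (ρ a) = a

/-- An involution is of the second kind if it is not the identity on the center. -/
def IsSecondKind {A : Type*} [Ring A] (ρ : A → A) : Prop :=
  ∃ a ∈ Subring.center A, ρ a ≠ a

/-- An involution on a poset: an order-reversing map which is its own inverse. -/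
structure IsPosetInvolution {X : Type*} [PartialOrder X] (l : X → X) : Prop where
  involutive : ∀ x, l (l x) = x
  le_iff : ∀ x y, x ≤ y ↔ l y ≤ l x

/-- A poset is connected if any two of its elements are joined by a finite sequence in which
consecutive elements are comparable. -/
def PosetConnected (X : Type*) [PartialOrder X] : Prop :=
  ∀ x y : X, Relation.ReflTransGen (fun a b => a ≤ b ∨ b ≤ a) x y

/-- The inner automorphism `a ↦ u a u⁻¹`. -/
def innerAut (K : Type*) {A : Type*} [Field K] [Ring A] [Algebra K A] (u : Aˣ) : A ≃ₐ[K] A where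
  toFun a := u * a * (u⁻¹ : Aˣ)
  invFun a := (u⁻¹ : Aˣ) * a * u
  left_inv a := by simp [mul_assoc]
  right_inv a := by simp [mul_assoc]
  map_mul' a b := by simp [mul_assoc]
  map_add' a b := by simp [mul_add, add_mul]
  commutes' k := by
    rw [← Algebra.commutes k (u : A), mul_assoc, Units.mul_inv, mul_one]

/-- Two involutions `ρ₁`, `ρ₂` on a `K`-algebra are equivalent via inner automorphisms if
`Ψ ∘ ρ₁ = ρ₂ ∘ Ψ` for some inner automorphism `Ψ`. -/
def EquivViaInner (K : Type*) {A : Type*} [Field K] [Ring A] [Algebra K A] (ρ₁ ρ₂ : A → A) :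
    Prop :=
  ∃ u : Aˣ, innerAut K u ∘ ρ₁ = ρ₂ ∘ innerAut K u

section FinitaryIncidence

variable {K X : Type*} [Field K] [PartialOrder X]

/-- The nontrivial subintervals `[u, v]` of `[x, y]` with `f u v ≠ 0`, each given by the pair of its
end points. -/
def finitarySupport (f : IncidenceAlgebra K X) (x y : X) : Set (X × X) :=
  {p | x ≤ p.1 ∧ p.1 < p.2 ∧ p.2 ≤ y ∧ f p.1 p.2 ≠ 0}

variable (K X) in
/-- The space `FI(X,K)`, inside the incidence space `I(X,K)`, of the functions `f` such that each
interval has only finitely many nontrivial subintervals `[u, v]` with `f u v ≠ 0`. (For the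
incidence space as a vector space, Mathlib's `IncidenceAlgebra K X` needs no local finiteness.) -/
def finitarySubmodule : Submodule K (IncidenceAlgebra K X) where
  carrier := {f | ∀ x y, x ≤ y → (finitarySupport f x y).Finite}
  zero_mem' := by
    intro x y _
    refine Set.Finite.subset Set.finite_empty ?_
    rintro p ⟨_, _, _, h⟩
    exact h rfl
  add_mem' := by
    intro f g hf hg x y hxy
    refine ((hf x y hxy).union (hg x y hxy)).subset ?_
    rintro p ⟨h1, h2, h3, h4⟩
    by_cases h : f p.1 p.2 = 0
    · refine Or.inr ⟨h1, h2, h3, fun h' => h4 ?_⟩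
      rw [IncidenceAlgebra.add_apply, h, h', add_zero]
    · exact Or.inl ⟨h1, h2, h3, h⟩
  smul_mem' := by
    intro c f hf x y hxy
    refine (hf x y hxy).subset ?_
    rintro p ⟨h1, h2, h3, h4⟩
    refine ⟨h1, h2, h3, fun h' => h4 ?_⟩
    rw [IncidenceAlgebra.constSMul_apply, h', smul_zero]

variable (K X) in
/-- The finitary incidence algebra `FI(X,K)`; its ring structure is defined below. -/
abbrev FI : Type _ := finitarySubmodule K X

namespace FI

theorem ext {f g : FI K X} (h : ∀ x y, x ≤ y → f.1 x y = g.1 x y) : f = g :=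
  Subtype.ext (IncidenceAlgebra.ext h)

theorem le_of_ne {f : IncidenceAlgebra K X} {x y : X} (h : f x y ≠ 0) : x ≤ y :=
  IncidenceAlgebra.le_of_ne_zero h

theorem convolution_eq (f g : IncidenceAlgebra K X) (x y : X) :
    ∑ᶠ z ∈ Set.Icc x y, f x z * g z y = ∑ᶠ z, f x z * g z y := by
  refine finsum_congr fun z => ?_
  by_cases hz : z ∈ Set.Icc x y
  · simp only [hz, finsum_true]
  · refine (show _ = (0 : K) by simp only [hz, finsum_false]).trans ?_
    by_contra h
    exact hz ⟨le_of_ne (left_ne_zero_of_mul (Ne.symm h)), le_of_ne (right_ne_zero_of_mul (Ne.symm h))⟩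

/-- The convolution product `(fg)(x,y) = ∑_{x ≤ z ≤ y} f(x,z) g(z,y)`, a sum with only finitely many
nonzero terms. -/
noncomputable instance : Mul (FI K X) where
  mul f g := ⟨⟨fun x y => ∑ᶠ z ∈ Set.Icc x y, f.1 x z * g.1 z y, by
      intro x y hxy
      rw [Set.Icc_eq_empty hxy]
      simp⟩, by
    intro x y hxy
    have hF := f.2 x y hxy
    have hG := g.2 x y hxy
    refine ((hF.union hG).union ((hF.prod hG).image fun q => (q.1.1, q.2.2))).subset ?_
    rintro ⟨u, v⟩ ⟨h1, h2, h3, h4⟩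
    obtain ⟨w, hw⟩ : ∃ w, f.1 u w * g.1 w v ≠ 0 := by
      by_contra! h
      refine h4 ?_
      simp only [IncidenceAlgebra.coe_mk]
      rw [convolution_eq, finsum_congr h, finsum_zero]
    have hfw := left_ne_zero_of_mul hw
    have hgw := right_ne_zero_of_mul hw
    have huw := le_of_ne hfw
    have hwv := le_of_ne hgw
    rcases huw.eq_or_lt with rfl | huw'
    · exact Or.inl (Or.inr ⟨h1, h2, h3, hgw⟩)
    rcases hwv.eq_or_lt with rfl | hwv'
    · exact Or.inl (Or.inl ⟨h1, h2, h3, hfw⟩)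
    exact Or.inr ⟨((u, w), (w, v)), ⟨⟨h1, huw', hwv.trans h3, hfw⟩,
      ⟨h1.trans huw, hwv', h3, hgw⟩⟩, rfl⟩⟩

open Classical in
/-- The unity `δ`. -/
noncomputable instance : One (FI K X) where
  one := ⟨⟨fun x y => if x = y then 1 else 0, fun x y h => if_neg fun e => h e.le⟩, by
    intro x y _
    refine Set.Finite.subset Set.finite_empty ?_
    rintro p ⟨_, h, _, h'⟩
    exact h' (if_neg h.ne)⟩

theorem mul_apply (f g : FI K X) (x y : X) :
    (f * g).1 x y = ∑ᶠ z ∈ Set.Icc x y, f.1 x z * g.1 z y := rfl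

theorem mul_apply' (f g : FI K X) (x y : X) :
    (f * g).1 x y = ∑ᶠ z, f.1 x z * g.1 z y := convolution_eq f.1 g.1 x y

open Classical in
theorem one_apply (x y : X) : (1 : FI K X).1 x y = if x = y then 1 else 0 := rfl

open Classical in
/-- A finite set of points carrying the values of `f` on intervals starting at `x` or ending at `y`,
inside `[x, y]`. -/
theorem exists_finset (f : FI K X) (x y : X) : ∃ S : Finset X,
    (∀ z, z ≤ y → f.1 x z ≠ 0 → z ∈ S) ∧ (∀ z, x ≤ z → f.1 z y ≠ 0 → z ∈ S) := by
  by_cases hxy : x ≤ y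
  · have hF := f.2 x y hxy
    refine ⟨insert x (insert y (hF.toFinset.image Prod.fst ∪ hF.toFinset.image Prod.snd)), ?_, ?_⟩
    · intro z hz h
      rcases (le_of_ne h).eq_or_lt with rfl | hlt
      · simp
      · have : (x, z) ∈ hF.toFinset := hF.mem_toFinset.2 ⟨le_rfl, hlt, hz, h⟩
        simp only [Finset.mem_insert, Finset.mem_union, Finset.mem_image]
        exact Or.inr (Or.inr (Or.inr ⟨_, this, rfl⟩))
    · intro z hz h
      rcases (le_of_ne h).eq_or_lt with rfl | hlt
      · simp
      · have : (z, y) ∈ hF.toFinset := hF.mem_toFinset.2 ⟨hz, hlt, le_rfl, h⟩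
        simp only [Finset.mem_insert, Finset.mem_union, Finset.mem_image]
        exact Or.inr (Or.inr (Or.inl ⟨_, this, rfl⟩))
  · exact ⟨∅, fun z hz h => absurd ((le_of_ne h).trans hz) hxy,
      fun z hz h => absurd (hz.trans (le_of_ne h)) hxy⟩

theorem mul_apply_left (f g : FI K X) {u y : X} (S : Finset X)
    (hS : ∀ z, z ≤ y → f.1 u z ≠ 0 → z ∈ S) :
    (f * g).1 u y = ∑ z ∈ S, f.1 u z * g.1 z y := by
  rw [mul_apply']
  refine finsum_eq_sum_of_support_subset _ fun z hz => ?_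
  exact hS z (le_of_ne (right_ne_zero_of_mul hz)) (left_ne_zero_of_mul hz)

theorem mul_apply_right (f g : FI K X) {x v : X} (S : Finset X)
    (hS : ∀ z, x ≤ z → g.1 z v ≠ 0 → z ∈ S) :
    (f * g).1 x v = ∑ z ∈ S, f.1 x z * g.1 z v := by
  rw [mul_apply']
  refine finsum_eq_sum_of_support_subset _ fun z hz => ?_
  exact hS z (le_of_ne (left_ne_zero_of_mul hz)) (right_ne_zero_of_mul hz)

theorem mul_assoc' (f g h : FI K X) : f * g * h = f * (g * h) := by
  refine ext fun x y hxy => ?_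
  obtain ⟨S, hS, -⟩ := exists_finset f x y
  obtain ⟨T, -, hT⟩ := exists_finset h x y
  rw [mul_apply_right (f * g) h T hT, mul_apply_left f (g * h) S hS]
  have h1 : ∀ z ∈ T, (f * g).1 x z * h.1 z y = ∑ w ∈ S, f.1 x w * g.1 w z * h.1 z y := by
    intro z _
    by_cases hz : h.1 z y = 0
    · simp [hz]
    · rw [mul_apply_left f g S (fun w hw hne => hS w (hw.trans (le_of_ne hz)) hne),
        Finset.sum_mul]
  have h2 : ∀ w ∈ S, f.1 x w * (g * h).1 w y = ∑ z ∈ T, f.1 x w * g.1 w z * h.1 z y := by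
    intro w _
    by_cases hw : f.1 x w = 0
    · simp [hw]
    · rw [mul_apply_right g h T (fun z hz hne => hT z ((le_of_ne hw).trans hz) hne),
        Finset.mul_sum]
      exact Finset.sum_congr rfl fun z _ => (mul_assoc _ _ _).symm
  rw [Finset.sum_congr rfl h1, Finset.sum_congr rfl h2, Finset.sum_comm]

theorem add_apply (f g : FI K X) (x y : X) : (f + g).1 x y = f.1 x y + g.1 x y := rfl

theorem smul_apply (c : K) (f : FI K X) (x y : X) : (c • f).1 x y = c * f.1 x y := rfl

noncomputable instance : Ring (FI K X) where
  __ := (inferInstance : AddCommGroup (FI K X))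
  mul_assoc := mul_assoc'
  one_mul f := ext fun x y _ => by
    rw [mul_apply_left (S := {x})]
    · simp [one_apply]
    · intro z _ h
      by_contra hz
      exact h (if_neg fun e => hz (by simp [e]))
  mul_one f := ext fun x y _ => by
    rw [mul_apply_right (S := {y})]
    · simp [one_apply]
    · intro z _ h
      by_contra hz
      exact h (if_neg fun e => hz (by simp [e]))
  zero_mul f := ext fun x y _ => by
    rw [mul_apply_left (S := ∅) (hS := fun z _ h => absurd rfl h)]; rfl
  mul_zero f := ext fun x y _ => by
    rw [mul_apply_right (S := ∅) (hS := fun z _ h => absurd rfl h)]; rfl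
  left_distrib f g h := ext fun x y _ => by
    obtain ⟨S, hS, -⟩ := exists_finset f x y
    rw [add_apply, mul_apply_left f _ S hS, mul_apply_left f _ S hS, mul_apply_left f _ S hS,
      ← Finset.sum_add_distrib]
    exact Finset.sum_congr rfl fun z _ => mul_add _ _ _
  right_distrib f g h := ext fun x y _ => by
    obtain ⟨S, -, hS⟩ := exists_finset h x y
    rw [add_apply, mul_apply_right _ h S hS, mul_apply_right _ h S hS, mul_apply_right _ h S hS,
      ← Finset.sum_add_distrib]
    exact Finset.sum_congr rfl fun z _ => add_mul _ _ _

noncomputable instance : Algebra K (FI K X) :=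
  Algebra.ofModule
    (fun c f g => ext fun x y _ => by
      obtain ⟨S, -, hS⟩ := exists_finset g x y
      rw [smul_apply, mul_apply_right _ g S hS, mul_apply_right _ g S hS, Finset.mul_sum]
      exact Finset.sum_congr rfl fun z _ => mul_assoc _ _ _)
    (fun c f g => ext fun x y _ => by
      obtain ⟨S, hS, -⟩ := exists_finset f x y
      rw [smul_apply, mul_apply_left f _ S hS, mul_apply_left f _ S hS, Finset.mul_sum]
      exact Finset.sum_congr rfl fun z _ => mul_left_comm _ _ _)

open Classical in
variable (K) in
/-- The idempotent `e_x`, with value `1` at `(x, x)` and `0` elsewhere. -/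
noncomputable def e (x : X) : FI K X :=
  ⟨⟨fun u v => if u = x ∧ v = x then 1 else 0, fun u v h =>
      if_neg fun ⟨hu, hv⟩ => h (hu.trans hv.symm).le⟩, by
    intro a b _
    refine Set.Finite.subset Set.finite_empty ?_
    rintro p ⟨_, h, _, h'⟩
    exact h' (if_neg fun ⟨hu, hv⟩ => h.ne (hu.trans hv.symm))⟩

/-- An element `σ` of the incidence space is multiplicative if `σ(x,y) ≠ 0` for all `x ≤ y` and
`σ(x,y) σ(y,z) = σ(x,z)` whenever `x ≤ y ≤ z`. -/
structure IsMultiplicative (σ : IncidenceAlgebra K X) : Prop where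
  ne_zero : ∀ x y, x ≤ y → σ x y ≠ 0
  mul : ∀ x y z, x ≤ y → y ≤ z → σ x y * σ y z = σ x z

/-- Entrywise multiplication by a function. -/
def scale (σ : X → X → K) (f : FI K X) : FI K X :=
  ⟨⟨fun x y => σ x y * f.1 x y, fun x y h => by
      rw [IncidenceAlgebra.apply_eq_zero_of_not_le h, mul_zero]⟩, by
    intro x y hxy
    refine (f.2 x y hxy).subset ?_
    rintro p ⟨h1, h2, h3, h4⟩
    exact ⟨h1, h2, h3, right_ne_zero_of_mul h4⟩⟩

theorem scale_apply (σ : X → X → K) (f : FI K X) (x y : X) :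
    (scale σ f).1 x y = σ x y * f.1 x y := rfl

/-- The multiplicative automorphism `M_σ`, given by `M_σ(f)(x,y) = σ(x,y) f(x,y)`. -/
noncomputable def multAut (σ : IncidenceAlgebra K X) (hσ : IsMultiplicative σ) :
    FI K X ≃ₐ[K] FI K X :=
  AlgEquiv.ofLinearEquiv
    { toFun := scale σ
      invFun := scale fun x y => (σ x y)⁻¹
      map_add' := fun f g => ext fun x y _ => mul_add _ _ _
      map_smul' := fun c f => ext fun x y _ => mul_left_comm _ _ _
      left_inv := fun f => ext fun x y hxy => by
        rw [scale_apply, scale_apply, inv_mul_cancel_left₀ (hσ.ne_zero x y hxy)]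
      right_inv := fun f => ext fun x y hxy => by
        rw [scale_apply, scale_apply, mul_inv_cancel_left₀ (hσ.ne_zero x y hxy)] }
    (ext fun x y hxy => by
      change σ x y * (1 : FI K X).1 x y = (1 : FI K X).1 x y
      by_cases h : x = y
      · subst h
        rw [one_apply, if_pos rfl, mul_one]
        exact mul_right_cancel₀ (hσ.ne_zero x x le_rfl)
          ((hσ.mul x x x le_rfl le_rfl).trans (one_mul _).symm)
      · rw [one_apply, if_neg h, mul_zero])
    (fun f g => ext fun x y hxy => by
      change σ x y * (f * g).1 x y = (scale σ f * scale σ g).1 x y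
      obtain ⟨S, hS, -⟩ := exists_finset f x y
      rw [mul_apply_left f g S hS, mul_apply_left (scale σ f) (scale σ g) S
        (fun z hz h => hS z hz (right_ne_zero_of_mul h)), Finset.mul_sum]
      refine Finset.sum_congr rfl fun z _ => ?_
      rw [scale_apply, scale_apply]
      by_cases hf : f.1 x z = 0
      · simp [hf]
      by_cases hg : g.1 z y = 0
      · simp [hg]
      rw [← hσ.mul x z y (le_of_ne hf) (le_of_ne hg)]
      ring)

variable (K X) in
/-- Every multiplicative automorphism of `FI(X,K)` is inner. -/
def MultAutInner : Prop :=
  ∀ (σ : IncidenceAlgebra K X) (hσ : IsMultiplicative σ),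
    ∃ u : (FI K X)ˣ, multAut σ hσ = innerAut K u

/-- The map `ρ` induces `l` on `X`: for each `x`, the element `ρ(e_x)` is conjugate to `e_{l x}`. -/
def InducesOnPoset (ρ : FI K X → FI K X) (l : X → X) : Prop :=
  ∀ x, ∃ u : (FI K X)ˣ, ρ (e K x) = innerAut K u (e K (l x))

/-- The map `ρ` induces `s` on `K`: its restriction to the scalars is `s`. -/
def InducesOnField (ρ : FI K X → FI K X) (s : K → K) : Prop :=
  ∀ a, ρ (algebraMap K (FI K X) a) = algebraMap K (FI K X) (s a)

/-- The map `ρ_l^s` on `FI(X,K)`, given by `ρ_l^s(f)(x,y) = s (f(l y, l x))`. -/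
def rho {l : X → X} (hl : IsPosetInvolution l) {s : K → K} (hs : IsAlgInvolution s)
    (f : FI K X) : FI K X :=
  have hs0 : s 0 = 0 := by simpa using hs.map_add 0 0
  ⟨⟨fun x y => s (f.1 (l y) (l x)), fun x y h => by
      rw [IncidenceAlgebra.apply_eq_zero_of_not_le (fun h' => h ((hl.le_iff x y).2 h')), hs0]⟩, by
    intro x y hxy
    have hinj : Function.Injective l := Function.LeftInverse.injective hl.involutive
    refine ((f.2 (l y) (l x) ((hl.le_iff x y).1 hxy)).preimage
      (f := fun p : X × X => (l p.2, l p.1)) ?_).subset ?_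
    · intro p _ q _ h
      exact Prod.ext (hinj (Prod.ext_iff.1 h).2) (hinj (Prod.ext_iff.1 h).1)
    · rintro ⟨u, v⟩ ⟨h1, h2, h3, h4⟩
      refine ⟨(hl.le_iff v y).1 h3, ?_, (hl.le_iff x u).1 h1, fun h => h4 ?_⟩
      · exact lt_of_le_of_ne ((hl.le_iff u v).1 h2.le) fun h => h2.ne (hinj h).symm
      · change s (f.1 (l v) (l u)) = 0
        rw [h, hs0]⟩

end FI

end FinitaryIncidence

/-! Write `τ` for `rho hl hs`. Since `ρ` and `τ` both reverse products and act on scalars by `s`,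
the composite `ρ ∘ τ` is a `K`-linear automorphism, and it preserves the diagonal of each idempotent
`e K x`. Such an automorphism is inner (`exists_eq_innerAut`): a single conjugation moves all the `e
K x` back to themselves, and what remains fixes them, hence is multiplicative, hence inner by
assumption. So `ρ f = w * τ f * w⁻¹` for a unit `w`.

Then `ρ ∘ ρ = id` makes `τ w * w⁻¹` central, so `τ w = d • w` for a scalar `d` with `s d * d = 1`.
Because `s` is of the second kind, Hilbert 90 rescales `w` so that `τ w = w`. Its entry at the fixed
point `x₀` is then fixed by `s`, so it can be divided out without losing symmetry.

It remains to write this symmetric `w` as `z * τ z`; conjugation by `z⁻¹` then carries `ρ` to `τ`.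
Off `x₀` the diagonal splits by choosing one point from each pair `{x, l x}`. What is left is
symmetric with unit diagonal, and has a symmetric square root given by a Catalan series, for which
only `2 ≠ 0` is needed. Series make sense because powers of an element with zero diagonal eventually
vanish on each interval. -/

/-- An infinite set carries, for any map without fixed points in it, an infinite subset disjoint from
its image. -/
theorem Set.Infinite.exists_infinite_subset_forall_apply_notMem {α : Type*} {Q : Set α}
    (hQ : Q.Infinite) (m : α → α) (hm : ∀ q ∈ Q, m q ≠ q) :
    ∃ S ⊆ Q, S.Infinite ∧ ∀ q ∈ S, m q ∉ S := by
  obtain ⟨S, hS⟩ := zorn_subset {S : Set α | S ⊆ Q ∧ ∀ q ∈ S, m q ∉ S} (by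
    intro c hc hchain
    refine ⟨⋃₀ c, ⟨Set.sUnion_subset fun s hs => (hc hs).1, ?_⟩, fun s hs =>
      Set.subset_sUnion_of_mem hs⟩
    rintro q ⟨s, hs, hq⟩ ⟨t, ht, hq'⟩
    rcases hchain.total hs ht with h | h
    · exact (hc ht).2 q (h hq) hq'
    · exact (hc hs).2 q hq (h hq'))
  by_cases hfin : S.Infinite
  · exact ⟨S, hS.prop.1, hfin, hS.prop.2⟩
  rw [Set.not_infinite] at hfin
  -- If the maximal `S` is finite, the rest of `Q` works: were `q` and `m q` both outside `S ∪ m ''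
  -- S`, then `insert q S` would still be admissible.
  refine ⟨Q \ (S ∪ m '' S), Set.sdiff_subset, hQ.sdiff (hfin.union (hfin.image m)), ?_⟩
  rintro q ⟨hq, hqS⟩ ⟨-, hmS⟩
  refine hqS (Or.inl (hS.le_of_ge (y := insert q S) ⟨?_, ?_⟩ (Set.subset_insert q S)
    (Set.mem_insert q S)))
  · exact Set.insert_subset hq hS.prop.1
  · rintro r (rfl | hr) (h | h)
    · exact hm r hq h
    · exact hmS (Or.inl h)
    · exact hqS (Or.inr ⟨r, hr, h⟩)
    · exact hS.prop.2 r hr h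

/-! ### Diagonal elements, matrix units and the center. -/

namespace FI

variable {K X : Type*} [Field K] [PartialOrder X]

theorem apply_eq_zero (f : FI K X) {x y : X} (h : ¬x ≤ y) : f.1 x y = 0 :=
  IncidenceAlgebra.apply_eq_zero_of_not_le h f.1

theorem sub_apply (f g : FI K X) (x y : X) : (f - g).1 x y = f.1 x y - g.1 x y := rfl

theorem mul_apply_self (f g : FI K X) (x : X) : (f * g).1 x x = f.1 x x * g.1 x x := by
  rw [mul_apply', finsum_eq_single _ x]
  intro z hz
  by_cases h : x ≤ z
  · rw [apply_eq_zero g fun h' => hz (h'.antisymm h), mul_zero]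
  · rw [apply_eq_zero f h, zero_mul]

open Classical in
/-- The diagonal element with the given diagonal. -/
noncomputable def diag (d : X → K) : FI K X :=
  ⟨⟨fun x y => if x = y then d x else 0, fun _ _ h => if_neg fun e => h e.le⟩, by
    intro x y _
    refine Set.Finite.subset Set.finite_empty ?_
    rintro p ⟨_, h, _, h'⟩
    exact h' (if_neg h.ne)⟩

open Classical in
theorem diag_apply (d : X → K) (x y : X) : (diag d).1 x y = if x = y then d x else 0 := rfl

theorem diag_apply_self (d : X → K) (x : X) : (diag d).1 x x = d x := if_pos rfl

theorem diag_mul_apply (d : X → K) (f : FI K X) (x y : X) :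
    (diag d * f).1 x y = d x * f.1 x y := by
  rw [mul_apply', finsum_eq_single _ x, diag_apply_self]
  intro z hz
  rw [diag_apply, if_neg hz.symm, zero_mul]

theorem mul_diag_apply (d : X → K) (f : FI K X) (x y : X) :
    (f * diag d).1 x y = f.1 x y * d y := by
  rw [mul_apply', finsum_eq_single _ y, diag_apply_self]
  intro z hz
  rw [diag_apply, if_neg hz, mul_zero]

theorem diag_mul_diag (d d' : X → K) : diag d * diag d' = diag (d * d') := by
  classical
  refine ext fun x y _ => ?_
  rw [diag_mul_apply, diag_apply, diag_apply, mul_ite, mul_zero]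
  rfl

theorem diag_one : diag (1 : X → K) = 1 := rfl

theorem diag_zero : diag (0 : X → K) = 0 := ext fun x y _ => by
  rw [diag_apply]; exact ite_self _

theorem isUnit_diag {d : X → K} (hd : ∀ x, d x ≠ 0) : IsUnit (diag d) :=
  ⟨⟨diag d, diag d⁻¹, by
    rw [diag_mul_diag, ← diag_one]; congr 1; ext x; exact mul_inv_cancel₀ (hd x), by
    rw [diag_mul_diag, ← diag_one]; congr 1; ext x; exact inv_mul_cancel₀ (hd x)⟩, rfl⟩

open Classical in
theorem e_eq_diag (x : X) : e K x = diag (Pi.single x 1) := ext fun u v _ => by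
  rw [diag_apply, Pi.single_apply]
  change (if u = x ∧ v = x then (1 : K) else 0) = _
  grind

open Classical in
theorem e_mul_apply (x : X) (f : FI K X) (a b : X) :
    (e K x * f).1 a b = if a = x then f.1 a b else 0 := by
  rw [e_eq_diag, diag_mul_apply, Pi.single_apply, ite_mul, one_mul, zero_mul]

open Classical in
theorem mul_e_apply (x : X) (f : FI K X) (a b : X) :
    (f * e K x).1 a b = if b = x then f.1 a b else 0 := by
  rw [e_eq_diag, mul_diag_apply, Pi.single_apply, mul_ite, mul_one, mul_zero]

open Classical in
theorem e_apply_self (x y : X) : (e K x).1 y y = if y = x then 1 else 0 := by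
  rw [e_eq_diag, diag_apply_self, Pi.single_apply]

theorem algebraMap_apply (c : K) (x y : X) :
    (algebraMap K (FI K X) c).1 x y = (diag fun _ => c : FI K X).1 x y := by
  classical
  rw [Algebra.algebraMap_eq_smul_one, smul_apply, one_apply, diag_apply, mul_ite, mul_one, mul_zero]

theorem algebraMap_eq_diag (c : K) : algebraMap K (FI K X) c = diag fun _ => c :=
  ext fun x y _ => algebraMap_apply c x y

open Classical in
/-- The matrix unit with value `1` at `(x, y)`. -/
noncomputable def matrixUnit (x y : X) (h : x ≤ y) : FI K X :=
  ⟨⟨fun u v => if u = x ∧ v = y then 1 else 0, fun u v huv =>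
      if_neg fun ⟨hu, hv⟩ => huv (hu ▸ hv ▸ h)⟩, by
    intro a b _
    refine Set.Finite.subset (Set.finite_singleton (x, y)) ?_
    rintro p ⟨_, _, _, h'⟩
    by_contra hp
    exact h' (if_neg fun ⟨hu, hv⟩ => hp (Prod.ext hu hv))⟩

open Classical in
theorem matrixUnit_apply {x y : X} (h : x ≤ y) (u v : X) :
    (matrixUnit x y h : FI K X).1 u v = if u = x ∧ v = y then 1 else 0 := rfl

theorem matrixUnit_apply_self {x y : X} (h : x ≤ y) : (matrixUnit x y h : FI K X).1 x y = 1 :=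
  if_pos ⟨rfl, rfl⟩

theorem e_mul_matrixUnit {x y : X} (h : x ≤ y) :
    e K x * matrixUnit x y h = matrixUnit x y h := ext fun u v _ => by
  rw [e_mul_apply, matrixUnit_apply]; grind

theorem matrixUnit_mul_e {x y : X} (h : x ≤ y) :
    matrixUnit x y h * e K y = matrixUnit x y h := ext fun u v _ => by
  rw [mul_e_apply, matrixUnit_apply]; grind

theorem matrixUnit_mul_apply {x y : X} (h : x ≤ y) (f : FI K X) (v : X) :
    (matrixUnit x y h * f).1 x v = f.1 y v := by
  rw [mul_apply', finsum_eq_single _ y, matrixUnit_apply_self, one_mul]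
  intro z hz
  rw [matrixUnit_apply, if_neg fun h' => hz h'.2, zero_mul]

theorem mul_matrixUnit_apply {x y : X} (h : x ≤ y) (f : FI K X) (u : X) :
    (f * matrixUnit x y h).1 u y = f.1 u x := by
  rw [mul_apply', finsum_eq_single _ x, matrixUnit_apply_self, mul_one]
  intro z hz
  rw [matrixUnit_apply, if_neg fun h' => hz h'.1, mul_zero]

theorem matrixUnit_mul_matrixUnit {x y z : X} (h : x ≤ y) (h' : y ≤ z) :
    matrixUnit x y h * matrixUnit y z h' = (matrixUnit x z (h.trans h') : FI K X) :=
  ext fun u v _ => by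
    rw [← e_mul_matrixUnit h, mul_assoc, e_mul_apply]
    split_ifs with hu
    · rw [hu, matrixUnit_mul_apply, matrixUnit_apply, matrixUnit_apply]; grind
    · rw [matrixUnit_apply, if_neg fun h => hu h.1]

theorem e_mul_mul_e {x y : X} (h : x ≤ y) (f : FI K X) :
    e K x * f * e K y = f.1 x y • matrixUnit x y h := ext fun u v _ => by
  rw [mul_e_apply, e_mul_apply, smul_apply, matrixUnit_apply]; grind

theorem eq_diag_of_forall_commute {c : FI K X} (hc : ∀ f, c * f = f * c) :
    c = diag fun x => c.1 x x := ext fun x y _ => by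
  classical
  rw [diag_apply]
  split_ifs with h
  · rw [h]
  · have := congrArg (fun f : FI K X => f.1 x y) (hc (e K x))
    simp only [e_mul_apply, mul_e_apply] at this
    rw [if_neg fun h' => h h'.symm, if_true] at this
    exact this.symm

/-- The center of the finitary incidence algebra of a connected poset consists of the scalars. -/
theorem eq_algebraMap_of_forall_commute (hX : PosetConnected X) (x₀ : X) {c : FI K X}
    (hc : ∀ f, c * f = f * c) : c = algebraMap K (FI K X) (c.1 x₀ x₀) := by
  have hle : ∀ x y, x ≤ y → c.1 x x = c.1 y y := fun x y h => by
    have := congrArg (fun f : FI K X => f.1 x y) (hc (matrixUnit x y h))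
    simpa only [mul_matrixUnit_apply, matrixUnit_mul_apply] using this
  have hconst : ∀ x, c.1 x₀ x₀ = c.1 x x := fun x => by
    induction hX x₀ x with
    | refl => rfl
    | tail _ h ih => exact ih.trans (h.elim (hle _ _) fun h => (hle _ _ h).symm)
  rw [algebraMap_eq_diag]
  refine (eq_diag_of_forall_commute hc).trans ?_
  congr 1
  ext x
  exact (hconst x).symm

/-! ### Agreement on intervals and limits -/

/-- Agreement of two elements on all subintervals of `[x, y]`. -/
def AgreeOn (x y : X) (f g : FI K X) : Prop := ∀ u v, x ≤ u → v ≤ y → f.1 u v = g.1 u v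

namespace AgreeOn

variable {x y : X} {f g h f' g' : FI K X}

theorem refl (f : FI K X) : AgreeOn x y f f := fun _ _ _ _ => rfl

theorem symm (H : AgreeOn x y f g) : AgreeOn x y g f := fun u v hu hv => (H u v hu hv).symm

theorem trans (H : AgreeOn x y f g) (H' : AgreeOn x y g h) : AgreeOn x y f h :=
  fun u v hu hv => (H u v hu hv).trans (H' u v hu hv)

theorem add (H : AgreeOn x y f g) (H' : AgreeOn x y f' g') : AgreeOn x y (f + f') (g + g') :=
  fun u v hu hv => by rw [add_apply, add_apply, H u v hu hv, H' u v hu hv]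

theorem mul (H : AgreeOn x y f g) (H' : AgreeOn x y f' g') : AgreeOn x y (f * f') (g * g') :=
  fun u v hu hv => by
    rw [mul_apply, mul_apply]
    refine finsum_congr fun z => finsum_congr fun hz => ?_
    rw [H u z hu (hz.2.trans hv), H' z v (hu.trans hz.1) hv]

end AgreeOn

theorem eq_of_agreeOn {f g : FI K X} (h : ∀ x y, x ≤ y → AgreeOn x y f g) : f = g :=
  ext fun x y hxy => h x y hxy x y le_rfl le_rfl

/-- A nonzero entry of `t ^ k` inside `[x, y]` comes from a strictly increasing chain of `k` steps,
each in the support of `t`. That support is finite on `[x, y]`, even if the interval is not, so `k`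
is bounded. The induction counts the support pairs whose left end lies above `u`; taking one step
from `u` to `z` discards `(u, z)`. -/
theorem exists_pow_agreeOn_zero {t : FI K X} (ht : ∀ x, t.1 x x = 0) {x y : X} (hxy : x ≤ y) :
    ∃ N, ∀ k ≥ N, AgreeOn x y (t ^ k) 0 := by
  classical
  set F := (t.2 x y hxy).toFinset with hF
  have key : ∀ k u v, x ≤ u → v ≤ y → (t ^ k).1 u v ≠ 0 → k ≤ (F.filter fun p => u ≤ p.1).card := by
    intro k
    induction k with
    | zero => intros; exact Nat.zero_le _
    | succ k ih =>
      intro u v hu hv h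
      obtain ⟨z, hz⟩ : ∃ z, t.1 u z * (t ^ k).1 z v ≠ 0 := by
        by_contra! h'
        rw [pow_succ', mul_apply', finsum_congr h', finsum_zero] at h
        exact h rfl
      have h1 := left_ne_zero_of_mul hz
      have h2 := right_ne_zero_of_mul hz
      have huz : u < z := (le_of_ne h1).lt_of_ne fun e => h1 (e ▸ ht u)
      refine Nat.succ_le_of_lt ((ih z v (hu.trans huz.le) hv h2).trans_lt (Finset.card_lt_card ?_))
      refine (Finset.ssubset_iff_of_subset fun p hp => ?_).2 ⟨(u, z), ?_, ?_⟩
      · rw [Finset.mem_filter] at hp ⊢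
        exact ⟨hp.1, huz.le.trans hp.2⟩
      · rw [Finset.mem_filter, hF, Set.Finite.mem_toFinset]
        exact ⟨⟨hu, huz, (le_of_ne h2).trans hv, h1⟩, le_rfl⟩
      · rw [Finset.mem_filter]
        exact fun h => huz.not_ge h.2
  refine ⟨F.card + 1, fun k hk u v hu hv => ?_⟩
  by_contra h
  have := (key k u v hu hv h).trans (Finset.card_filter_le _ _)
  omega

/-- The entry at `(u, v)` is read off at the stage where `[u, v]` has stabilized. On a larger
interval `[x, y]` all these entries coincide with those of the one element `g (N x y)`, which makes
the limit finitary. -/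
theorem exists_limit_of_agreeOn (g : ℕ → FI K X)
    (hg : ∀ x y, x ≤ y → ∃ N, ∀ k ≥ N, AgreeOn x y (g (k + 1)) (g k)) :
    ∃ G : FI K X, ∀ x y, x ≤ y → ∃ N, ∀ k ≥ N, AgreeOn x y G (g k) := by
  classical
  choose! N hN using hg
  have hN' : ∀ x y, x ≤ y → ∀ k ≥ N x y, AgreeOn x y (g k) (g (N x y)) := by
    intro x y hxy k hk
    induction k, hk using Nat.le_induction with
    | base => exact .refl _
    | succ k hk ih => exact (hN x y hxy k hk).trans ih
  have hG : ∀ x y, x ≤ y → ∀ u v, x ≤ u → u ≤ v → v ≤ y →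
      (g (N u v)).1 u v = (g (N x y)).1 u v := by
    intro x y hxy u v hu huv hv
    rw [← hN' u v huv (max (N u v) (N x y)) (le_max_left _ _) u v le_rfl le_rfl,
      ← hN' x y hxy (max (N u v) (N x y)) (le_max_right _ _) u v hu hv]
  refine ⟨⟨⟨fun u v => (g (N u v)).1 u v, fun u v h => apply_eq_zero _ h⟩, ?_⟩, ?_⟩
  · intro x y hxy
    refine ((g (N x y)).2 x y hxy).subset ?_
    rintro p ⟨h1, h2, h3, h4⟩
    refine ⟨h1, h2, h3, ?_⟩
    rw [← hG x y hxy p.1 p.2 h1 h2.le h3]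
    exact h4
  · refine fun x y hxy => ⟨N x y, fun k hk u v hu hv => ?_⟩
    by_cases huv : u ≤ v
    · rw [hN' x y hxy k hk u v hu hv]
      exact hG x y hxy u v hu huv hv
    · rw [apply_eq_zero _ huv, apply_eq_zero _ huv]

theorem exists_limit {t : FI K X} (ht : ∀ x, t.1 x x = 0) (g : ℕ → FI K X)
    (hg : ∀ k, ∃ h, g (k + 1) = g k + t ^ k * h) :
    ∃ G : FI K X, ∀ x y, x ≤ y → ∃ N, ∀ k ≥ N, AgreeOn x y G (g k) := by
  refine exists_limit_of_agreeOn g fun x y hxy => ?_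
  obtain ⟨N, hN⟩ := exists_pow_agreeOn_zero ht hxy
  refine ⟨N, fun k hk => ?_⟩
  obtain ⟨h, hh⟩ := hg k
  have := (AgreeOn.refl (g k)).add ((hN k hk).mul (.refl h))
  rwa [zero_mul, add_zero, ← hh] at this

/-- The inverse is the geometric series in `1 - u`, which has zero diagonal. -/
theorem isUnit_of_diagonal_one {u : FI K X} (hu : ∀ x, u.1 x x = 1) : IsUnit u := by
  classical
  set t := 1 - u with ht'
  have ht : ∀ x, t.1 x x = 0 := fun x => by
    rw [sub_apply, hu, one_apply, if_pos rfl, sub_self]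
  obtain ⟨G, hG⟩ := exists_limit ht (fun k => ∑ i ∈ Finset.range k, t ^ i)
    fun k => ⟨1, by rw [mul_one, Finset.sum_range_succ]⟩
  have hut : u = 1 - t := by rw [ht', sub_sub_cancel]
  have h1 : 1 + t * G = G := eq_of_agreeOn fun x y hxy => by
    obtain ⟨N, hN⟩ := hG x y hxy
    have h := (AgreeOn.refl 1).add ((AgreeOn.refl t).mul (hN N le_rfl))
    refine h.trans (AgreeOn.trans ?_ (hN (N + 1) (Nat.le_succ N)).symm)
    rw [Finset.sum_range_succ', Finset.mul_sum, add_comm, pow_zero]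
    simp only [pow_succ']
    exact .refl _
  have h2 : 1 + G * t = G := eq_of_agreeOn fun x y hxy => by
    obtain ⟨N, hN⟩ := hG x y hxy
    have h := (AgreeOn.refl 1).add ((hN N le_rfl).mul (AgreeOn.refl t))
    refine h.trans (AgreeOn.trans ?_ (hN (N + 1) (Nat.le_succ N)).symm)
    rw [Finset.sum_range_succ', Finset.sum_mul, add_comm, pow_zero]
    simp only [pow_succ]
    exact .refl _
  refine ⟨⟨u, G, ?_, ?_⟩, rfl⟩
  · rw [hut, sub_mul, one_mul, sub_eq_iff_eq_add, h1]
  · rw [hut, mul_sub, mul_one, sub_eq_iff_eq_add, h2]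

end FI
namespace FI

variable {K X : Type*} [Field K] [PartialOrder X]

/-! ### Automorphisms -/

theorem innerAut_apply_self (u : (FI K X)ˣ) (f : FI K X) (x : X) :
    (innerAut K u f).1 x x = f.1 x x := by
  change ((u : FI K X) * f * (u⁻¹ : (FI K X)ˣ)).1 x x = _
  rw [mul_apply_self, mul_apply_self, mul_right_comm, ← mul_apply_self, Units.mul_inv]
  classical
  rw [one_apply, if_pos rfl, one_mul]

theorem indicator_mul_indicator (S T : Set X) :
    (diag (S.indicator 1) * diag (T.indicator 1) : FI K X) = diag ((S ∩ T).indicator 1) := by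
  classical
  rw [diag_mul_diag]
  congr 1
  ext x
  simp only [Pi.mul_apply, Set.indicator_apply, Set.mem_inter_iff, Pi.one_apply]
  grind

theorem e_eq_indicator (x : X) : e K x = diag (({x} : Set X).indicator 1) := by
  classical
  rw [e_eq_diag]
  congr 1
  ext y
  simp [Set.indicator_apply, Pi.single_apply]

theorem e_mul_e_self (x : X) : e K x * e K x = e K x := by
  rw [e_eq_indicator, indicator_mul_indicator, Set.inter_self]

theorem e_mul_e_of_ne {x y : X} (h : x ≠ y) : e K x * e K y = 0 := by
  rw [e_eq_indicator, e_eq_indicator, indicator_mul_indicator,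
    Set.singleton_inter_eq_empty.2 (by simpa using h), Set.indicator_empty, ← diag_zero]
  rfl

section

variable {Φ : FI K X ≃ₐ[K] FI K X}

/-- The images of the idempotents `e_q` under an automorphism have finitary columns. -/
theorem finite_column_support (hΦ : ∀ x y, (Φ (e K x)).1 y y = (e K x).1 y y) (x y : X)
    (hxy : x ≤ y) :
    {p : X × X | x ≤ p.1 ∧ p.1 < p.2 ∧ p.2 ≤ y ∧ (Φ (e K p.2)).1 p.1 p.2 ≠ 0}.Finite := by
  classical
  by_contra hinf
  set B := {p : X × X | x ≤ p.1 ∧ p.1 < p.2 ∧ p.2 ≤ y ∧ (Φ (e K p.2)).1 p.1 p.2 ≠ 0} with hB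
  -- Each `Φ (e K q)` is finitary, so finitely many columns would contribute only finitely many
  -- pairs.
  have hQ : (Prod.snd '' B).Infinite := fun hfin => hinf <|
    (hfin.biUnion fun q _ => (Φ (e K q)).2 x y hxy).subset fun p hp =>
      Set.mem_biUnion (Set.mem_image_of_mem _ hp) hp
  have hmax : ∀ q ∈ Prod.snd '' B, ∃ p, (p, q) ∈ B ∧ ∀ z, p < z → z < q →
      (Φ (e K q)).1 z q = 0 := by
    rintro _ ⟨⟨p, q⟩, hp, rfl⟩
    have hfin : {p | (p, q) ∈ B}.Finite :=
      (((Φ (e K q)).2 x y hxy).image Prod.fst).subset fun p hp => ⟨(p, q), hp, rfl⟩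
    obtain ⟨m, hm⟩ := hfin.exists_maximal ⟨p, hp⟩
    refine ⟨m, hm.prop, fun z hmz hzq => ?_⟩
    by_contra hz
    exact hm.not_prop_of_gt hmz ⟨hm.prop.1.trans hmz.le, hzq, hm.prop.2.2.1, hz⟩
  choose! m hmB hm using hmax
  -- `m q` is the row of a maximal nonzero entry strictly above the diagonal in column `q`. With `m
  -- q ∉ S`, the diagonal of `E` below vanishes at `m q`.
  obtain ⟨S, hSQ, hSinf, hS⟩ := hQ.exists_infinite_subset_forall_apply_notMem m
    fun q hq => (hmB q hq).2.1.ne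
  set E := Φ (diag (S.indicator 1)) with hE
  have hEe : ∀ q ∈ S, E * Φ (e K q) = Φ (e K q) := fun q hq => by
    rw [hE, ← map_mul, e_eq_indicator, indicator_mul_indicator,
      Set.inter_eq_right.2 (Set.singleton_subset_iff.2 hq)]
  have hE0 : ∀ p ∉ S, E.1 p p = 0 := fun p hp => by
    have h : E * Φ (e K p) = 0 := by
      rw [hE, ← map_mul, e_eq_indicator, indicator_mul_indicator,
        Set.inter_singleton_eq_empty.2 hp, Set.indicator_empty]
      exact (congrArg Φ diag_zero).trans (map_zero Φ)
    have h' := mul_apply_self E (Φ (e K p)) p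
    rw [h, hΦ, e_apply_self, if_pos rfl, mul_one] at h'
    exact h'.symm
  -- In `E * Φ (e K q) = Φ (e K q)` at `(m q, q)`, maximality leaves only the terms `z = m q` and `z
  -- = q`, and the first is zero. So `E` is nonzero at `(m q, q)` for every `q ∈ S`, infinitely
  -- often inside `[x, y]`.
  refine hSinf (((E.2 x y hxy).image Prod.snd).subset fun q hq => ⟨(m q, q), ?_, rfl⟩)
  obtain ⟨h1, h2, h3, h4⟩ := hmB q (hSQ hq)
  refine ⟨h1, h2, h3, fun h0 => h4 ?_⟩
  change (Φ (e K q)).1 (m q) q = 0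
  rw [← hEe q hq, mul_apply']
  refine (finsum_congr fun z => ?_).trans finsum_zero
  change E.1 (m q) q = 0 at h0
  by_cases hz : (Φ (e K q)).1 z q = 0
  · rw [hz, mul_zero]
  rcases (le_of_ne hz).eq_or_lt with rfl | hzq
  · rw [h0, zero_mul]
  by_cases hmz : m q ≤ z
  · rcases hmz.eq_or_lt with h | hmz
    · rw [← h, hE0 _ (hS q hq), zero_mul]
    · exact absurd (hm q (hSQ hq) z hmz hzq) hz
  · rw [apply_eq_zero E hmz, zero_mul]

/-- An automorphism preserving the diagonals of the idempotents `e_x` agrees on all of them with a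
single inner automorphism. -/
theorem exists_unit_forall_map_e (hΦ : ∀ x y, (Φ (e K x)).1 y y = (e K x).1 y y) :
    ∃ u : (FI K X)ˣ, ∀ x, Φ (e K x) = innerAut K u (e K x) := by
  classical
  -- Formally `u = ∑ q, Φ (e K q) * e K q`, so orthogonality of the idempotents gives `Φ (e K x) * u
  -- = u * e K x`.
  let u : FI K X := ⟨⟨fun p q => (Φ (e K q)).1 p q, fun p q h => apply_eq_zero _ h⟩,
    finite_column_support hΦ⟩
  have hu : ∀ x, u.1 x x = 1 := fun x => (hΦ x x).trans (by rw [e_apply_self, if_pos rfl])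
  obtain ⟨v, hv⟩ := isUnit_of_diagonal_one hu
  refine ⟨v, fun x => ?_⟩
  change _ = (v : FI K X) * e K x * (v⁻¹ : (FI K X)ˣ)
  rw [Units.eq_mul_inv_iff_mul_eq, hv]
  refine ext fun a b _ => ?_
  rw [mul_e_apply]
  have h : (Φ (e K x) * u).1 a b = (Φ (e K x) * Φ (e K b)).1 a b := by
    rw [mul_apply', mul_apply']
    rfl
  rw [h, ← map_mul]
  split_ifs with hb
  · rw [hb, e_mul_e_self]
    rfl
  · rw [e_mul_e_of_ne (Ne.symm hb), map_zero]
    rfl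

/-- An automorphism fixing the idempotents `e_x` is multiplicative. -/
theorem exists_eq_multAut (hΦ : ∀ x, Φ (e K x) = e K x) :
    ∃ (σ : IncidenceAlgebra K X) (hσ : IsMultiplicative σ), Φ = multAut σ hσ := by
  classical
  let σ : IncidenceAlgebra K X := ⟨fun x y => if h : x ≤ y then (Φ (matrixUnit x y h)).1 x y else 0,
    fun x y h => dif_neg h⟩
  have hσ : ∀ x y (h : x ≤ y), σ x y = (Φ (matrixUnit x y h)).1 x y := fun x y h => dif_pos h
  have hunit : ∀ x y (h : x ≤ y), Φ (matrixUnit x y h) = σ x y • matrixUnit x y h := by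
    intro x y h
    rw [hσ x y h, ← e_mul_mul_e h]
    nth_rw 1 [← hΦ x, ← hΦ y]
    rw [← map_mul, ← map_mul, e_mul_matrixUnit, matrixUnit_mul_e]
  have hne : ∀ x y, x ≤ y → σ x y ≠ 0 := by
    intro x y h h0
    have h1 := hunit x y h
    rw [h0, zero_smul, map_eq_zero_iff Φ Φ.injective] at h1
    have h2 := matrixUnit_apply_self (K := K) h
    rw [h1] at h2
    exact zero_ne_one h2
  have hmul : ∀ x y z, x ≤ y → y ≤ z → σ x y * σ y z = σ x z := by
    intro x y z h h'
    have h1 := congrArg Φ (matrixUnit_mul_matrixUnit (K := K) h h')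
    rw [map_mul, hunit, hunit, hunit, smul_mul_smul_comm, matrixUnit_mul_matrixUnit] at h1
    have h2 := congrArg (fun f : FI K X => f.1 x z) h1
    simpa only [smul_apply, matrixUnit_apply_self, mul_one] using h2
  refine ⟨σ, ⟨hne, hmul⟩, AlgEquiv.ext fun f => ext fun x y h => ?_⟩
  change _ = σ x y * f.1 x y
  -- Matrix units need not span, but each entry of `f` is isolated by the fixed idempotents `e K x`
  -- and `e K y`.
  have h1 := congrArg Φ (e_mul_mul_e h f)
  rw [map_mul, map_mul, hΦ, hΦ, map_smul, hunit, e_mul_mul_e h] at h1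
  have h2 := congrArg (fun f : FI K X => f.1 x y) h1
  simp only [smul_apply, matrixUnit_apply_self, mul_one] at h2
  rw [h2, mul_comm]

/-- If multiplicative automorphisms are inner, so is every automorphism preserving the diagonals of
the idempotents `e_x`. -/
theorem exists_eq_innerAut (hmult : MultAutInner K X)
    (hΦ : ∀ x y, (Φ (e K x)).1 y y = (e K x).1 y y) :
    ∃ w : (FI K X)ˣ, ∀ f, Φ f = innerAut K w f := by
  obtain ⟨u, hu⟩ := exists_unit_forall_map_e hΦ
  obtain ⟨σ, hσ, h⟩ := exists_eq_multAut (Φ := Φ.trans (innerAut K u).symm) fun x => by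
    rw [AlgEquiv.trans_apply, hu, AlgEquiv.symm_apply_apply]
  obtain ⟨v, hv⟩ := hmult σ hσ
  refine ⟨u * v, fun f => ?_⟩
  have h1 := congrArg (innerAut K u) (AlgEquiv.congr_fun (h.trans hv) f)
  rw [AlgEquiv.trans_apply, AlgEquiv.apply_symm_apply] at h1
  rw [h1]
  change (u : FI K X) * ((v : FI K X) * f * (v⁻¹ : (FI K X)ˣ)) * (u⁻¹ : (FI K X)ˣ) =
    ((u * v : (FI K X)ˣ) : FI K X) * f * ((u * v)⁻¹ : (FI K X)ˣ)
  simp only [mul_inv_rev, Units.val_mul, mul_assoc]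

end

/-! ### The involution `ρ_l^s` -/

section

variable {l : X → X} (hl : IsPosetInvolution l) {s : K → K} (hs : IsAlgInvolution s)

/-- An involution on a field, as a ring automorphism. -/
def _root_.IsAlgInvolution.ringEquiv {K : Type*} [Field K] {s : K → K} (hs : IsAlgInvolution s) :
    K ≃+* K where
  toFun := s
  invFun := s
  left_inv := hs.involutive
  right_inv := hs.involutive
  map_mul' a b := by rw [hs.map_mul, mul_comm]
  map_add' := hs.map_add

theorem rho_apply (f : FI K X) (x y : X) : (rho hl hs f).1 x y = s (f.1 (l y) (l x)) := rfl

theorem isAlgInvolution_rho : IsAlgInvolution (rho hl hs) where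
  map_add f g := ext fun x y _ => hs.map_add _ _
  map_mul f g := ext fun x y _ => by
    rw [rho_apply, mul_apply', mul_apply']
    refine (hs.ringEquiv.toAddEquiv.map_finsum _).trans ?_
    let L : X ≃ X := ⟨l, l, hl.involutive, hl.involutive⟩
    rw [← finsum_comp_equiv L]
    refine finsum_congr fun z => ?_
    change s (f.1 (l y) (l z) * g.1 (l z) (l x)) = s (g.1 (l z) (l x)) * s (f.1 (l y) (l z))
    rw [hs.map_mul]
  involutive f := ext fun x y _ => by
    rw [rho_apply, rho_apply, hs.involutive, hl.involutive, hl.involutive]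

theorem rho_diag (d : X → K) : rho hl hs (diag d) = diag fun x => s (d (l x)) := by
  classical
  refine ext fun x y _ => ?_
  rw [rho_apply, diag_apply, diag_apply]
  by_cases h : x = y
  · rw [if_pos (h ▸ rfl), if_pos h, h]
  · rw [if_neg fun h' => h (Function.LeftInverse.injective hl.involutive h').symm, if_neg h]
    exact map_zero hs.ringEquiv

theorem rho_e (x : X) : rho hl hs (e K x) = e K (l x) := by
  classical
  rw [e_eq_diag, rho_diag, e_eq_diag]
  congr 1
  ext y
  rw [Pi.single_apply, Pi.single_apply]
  by_cases h : y = l x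
  · rw [if_pos (by rw [h, hl.involutive]), if_pos h]
    exact map_one hs.ringEquiv
  · rw [if_neg fun h' => h (by rw [← h', hl.involutive]), if_neg h]
    exact map_zero hs.ringEquiv

theorem rho_algebraMap (c : K) :
    rho hl hs (algebraMap K (FI K X) c) = algebraMap K (FI K X) (s c) := by
  rw [algebraMap_eq_diag, rho_diag, algebraMap_eq_diag]

theorem AgreeOn.rho {x y : X} {f g : FI K X} (h : AgreeOn (l y) (l x) f g) :
    AgreeOn x y (rho hl hs f) (rho hl hs g) := fun u v hu hv => by
  rw [rho_apply, rho_apply, h _ _ ((hl.le_iff v y).1 hv) ((hl.le_iff x u).1 hu)]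

end

end FI
/-- Hilbert's Theorem 90 for an involution of the second kind on a field. -/
theorem IsAlgInvolution.exists_ne_zero_map_mul_eq {K : Type*} [Field K] {s : K → K}
    (hs : IsAlgInvolution s) (hs₂ : IsSecondKind s) {d : K} (hd : s d * d = 1) :
    ∃ b ≠ 0, s b * d = b := by
  -- The witness is `b = 1 + d`; when this vanishes, `d = -1` and any nonzero `a - s a` serves.
  by_cases h : 1 + d = 0
  · obtain ⟨a, -, ha⟩ := hs₂
    have hsub : s (a - s a) = s a - s (s a) := map_sub hs.ringEquiv a (s a)
    refine ⟨a - s a, sub_ne_zero.2 (Ne.symm ha), ?_⟩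
    rw [hsub, hs.involutive, eq_neg_of_add_eq_zero_right h]
    ring
  · have h1 : s 1 = 1 := map_one hs.ringEquiv
    refine ⟨1 + d, h, ?_⟩
    rw [hs.map_add, h1, add_mul, one_mul, hd, add_comm]

/-- The Picard iteration for `C = 1 + x C²` converges `x`-adically. -/
theorem exists_iterate_succ_eq_add_pow_mul {R : Type*} [CommRing R] (x : R) (k : ℕ) :
    ∃ h, (fun a => 1 + x * (a * a))^[k + 1] 0 = (fun a => 1 + x * (a * a))^[k] 0 + x ^ k * h := by
  induction k with
  | zero => exact ⟨1, by simp⟩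
  | succ k ih =>
    obtain ⟨h, hh⟩ := ih
    set F := fun a => 1 + x * (a * a) with hF
    refine ⟨h * (F^[k + 1] 0 + F^[k] 0), ?_⟩
    rw [Function.iterate_succ_apply' F (k + 1)]
    nth_rw 2 [Function.iterate_succ_apply' F k]
    change 1 + x * (F^[k + 1] 0 * F^[k + 1] 0) = 1 + x * (F^[k] 0 * F^[k] 0) + _
    have : x ^ k * h = F^[k + 1] 0 - F^[k] 0 := by rw [hh]; ring
    rw [pow_succ', mul_assoc x, ← mul_assoc (x ^ k), this]
    ring

/-! ### Symmetric square roots and norms. -/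

namespace FI

open Polynomial

variable {K X : Type*} [Field K] [PartialOrder X]
variable {l : X → X} (hl : IsPosetInvolution l) {s : K → K} (hs : IsAlgInvolution s)

theorem rho_one : rho hl hs 1 = 1 := by
  have h := rho_algebraMap hl hs 1
  have h1 : s 1 = 1 := map_one hs.ringEquiv
  rwa [h1, map_one] at h

theorem rho_smul (c : K) (f : FI K X) : rho hl hs (c • f) = s c • rho hl hs f :=
  ext fun _ _ _ => map_mul hs.ringEquiv _ _

theorem rho_sub (f g : FI K X) : rho hl hs (f - g) = rho hl hs f - rho hl hs g :=
  ext fun _ _ _ => map_sub hs.ringEquiv _ _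

/-- The Catalan series evaluated at a symmetric strictly triangular element. -/
theorem exists_catalan {t : FI K X} (ht : ∀ x, t.1 x x = 0) (hτ : rho hl hs t = t) :
    ∃ C, rho hl hs C = C ∧ t * C = C * t ∧ 1 + t * (C * C) = C := by
  -- The iterates are taken in the commutative ring `ℤ[X]`, then evaluated at `t`: this yields
  -- commutation with `t` and increments divisible by `t ^ k`.
  set P : ℕ → ℤ[X] := fun k => (fun a => 1 + (Polynomial.X : ℤ[X]) * (a * a))^[k] 0 with hP
  have hPs : ∀ k, P (k + 1) = 1 + Polynomial.X * (P k * P k) := fun k =>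
    Function.iterate_succ_apply' _ _ _
  set g : ℕ → FI K X := fun k => aeval t (P k) with hg
  have hgs : ∀ k, g (k + 1) = 1 + t * (g k * g k) := fun k => by
    simp only [hg, hPs, map_add, map_mul, map_one, aeval_X]
  have hcomm : ∀ k, t * g k = g k * t := fun k => by
    have := congrArg (aeval t) (mul_comm Polynomial.X (P k))
    rwa [map_mul, map_mul, aeval_X] at this
  have hinv := isAlgInvolution_rho hl hs
  have hgτ : ∀ k, rho hl hs (g k) = g k := by
    intro k
    induction k with
    | zero =>
      have : g 0 = 0 := map_zero (aeval t)
      rw [this, ← sub_self (0 : FI K X), rho_sub, sub_self, sub_self]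
    | succ k ih =>
      rw [hgs, hinv.map_add, rho_one, hinv.map_mul, hinv.map_mul, ih, hτ, mul_assoc, ← hcomm,
        ← mul_assoc, ← hcomm, mul_assoc]
  obtain ⟨C, hC⟩ := exists_limit ht g fun k => by
    obtain ⟨h, hh⟩ := exists_iterate_succ_eq_add_pow_mul (Polynomial.X : ℤ[X]) k
    refine ⟨aeval t h, ?_⟩
    have := congrArg (aeval t) hh
    rwa [map_add, map_mul, map_pow, aeval_X] at this
  refine ⟨C, eq_of_agreeOn fun x y hxy => ?_, eq_of_agreeOn fun x y hxy => ?_,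
    eq_of_agreeOn fun x y hxy => ?_⟩
  · obtain ⟨N, hN⟩ := hC x y hxy
    -- `rho hl hs` carries agreement on `[l y, l x]` to agreement on `[x, y]`, so both intervals
    -- must have stabilized.
    obtain ⟨M, hM⟩ := hC (l y) (l x) ((hl.le_iff x y).1 hxy)
    have h := (hM (max M N) (le_max_left _ _)).rho hl hs
    rw [hgτ] at h
    exact h.trans (hN (max M N) (le_max_right _ _)).symm
  · obtain ⟨N, hN⟩ := hC x y hxy
    have h := (AgreeOn.refl t).mul (hN N le_rfl)
    rw [hcomm] at h
    exact h.trans ((hN N le_rfl).mul (.refl t)).symm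
  · obtain ⟨N, hN⟩ := hC x y hxy
    have h := (AgreeOn.refl 1).add ((AgreeOn.refl t).mul ((hN N le_rfl).mul (hN N le_rfl)))
    rw [← hgs] at h
    exact h.trans (hN (N + 1) (Nat.le_succ N)).symm

/-- A symmetric element with unit diagonal is the square of a symmetric unit. -/
theorem exists_sqrt (h2 : (2 : K) ≠ 0) {w : FI K X} (hw : ∀ x, w.1 x x = 1)
    (hτ : rho hl hs w = w) : ∃ z, IsUnit z ∧ rho hl hs z = z ∧ z * z = w := by
  classical
  have h4 : (4 : K) ≠ 0 := by
    have : (4 : K) = 2 * 2 := by norm_num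
    rw [this]
    exact mul_ne_zero h2 h2
  have hs4 : s (4⁻¹) = 4⁻¹ := by
    have : hs.ringEquiv (4⁻¹) = 4⁻¹ := by rw [map_inv₀, map_ofNat]
    exact this
  -- If `C = 1 + t * C ^ 2`, then `(1 - 2 * t * C) ^ 2 = 1 - 4 * t * (C - t * C ^ 2) = 1 - 4 * t =
  -- w`.
  set t : FI K X := (4⁻¹ : K) • (1 - w) with ht
  have hwt : w = 1 - 4 * t := by
    have : (4 : FI K X) * t = (4 : K) • t := by
      rw [Algebra.smul_def, map_ofNat]
    rw [this, ht, smul_inv_smul₀ h4, sub_sub_cancel]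
  obtain ⟨C, hCτ, hcomm, hC⟩ := exists_catalan hl hs (t := t)
    (fun x => by rw [ht, smul_apply, sub_apply, hw, one_apply, if_pos rfl, sub_self, mul_zero])
    (by rw [ht, rho_smul, rho_sub, rho_one, hτ, hs4])
  have hinv := isAlgInvolution_rho hl hs
  have hzz : (1 - (t * C + t * C)) * (1 - (t * C + t * C)) = w := by
    have h1 : t * C * (t * C) = t * (C - 1) := by
      conv_rhs => rw [← hC]
      rw [add_sub_cancel_left, ← mul_assoc, mul_assoc t C t, ← hcomm]
      simp only [mul_assoc]
    have h3 : (1 - (t * C + t * C)) * (1 - (t * C + t * C)) =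
        1 - 4 * (t * C) + 4 * (t * C * (t * C)) := by
      noncomm_ring
    rw [h3, h1, hwt]
    noncomm_ring
  refine ⟨1 - (t * C + t * C), ?_, ?_, hzz⟩
  · have := isUnit_of_diagonal_one hw
    rw [← hzz] at this
    exact ((Commute.refl _).isUnit_mul_iff.1 this).1
  · have htτ : rho hl hs t = t := by rw [ht, rho_smul, rho_sub, rho_one, hτ, hs4]
    rw [rho_sub, rho_one, hinv.map_add, hinv.map_mul, hCτ, htτ, hcomm]

/-- If `l` has a single fixed point, a symmetric element which is normalized there and has nonzero
diagonal entries is a norm. -/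
theorem exists_mul_rho_eq (h2 : (2 : K) ≠ 0) {x₀ : X} (hx₀ : ∀ x, l x = x → x = x₀)
    {w : FI K X} (hw : ∀ x, w.1 x x ≠ 0) (hw₀ : w.1 x₀ x₀ = 1) (hτ : rho hl hs w = w) :
    ∃ z, IsUnit z ∧ z * rho hl hs z = w := by
  classical
  have hinv := isAlgInvolution_rho hl hs
  have hs1 : s 1 = 1 := map_one hs.ringEquiv
  have hs0 : ∀ a, a ≠ 0 → s a ≠ 0 := fun a ha => (map_ne_zero_iff _ hs.ringEquiv.injective).2 ha
  have hwl : ∀ x, s (w.1 (l x) (l x)) = w.1 x x := fun x => by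
    rw [← rho_apply hl hs, hτ]
  -- The well-ordering selects one point of each pair `{x, l x}` to carry the whole diagonal entry;
  -- at `x₀` the entry is already `1`.
  set d : X → K := fun x => if WellOrderingRel x (l x) then w.1 x x else 1 with hd
  have hd0 : ∀ x, d x ≠ 0 := fun x => by
    simp only [hd]
    split_ifs
    exacts [hw x, one_ne_zero]
  have hdw : ∀ x, d x * s (d (l x)) = w.1 x x := fun x => by
    simp only [hd, hl.involutive]
    rcases trichotomous_of WellOrderingRel x (l x) with h | h | h
    · rw [if_pos h, if_neg (asymm_of WellOrderingRel h), hs1, mul_one]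
    · rw [← h, if_neg (irrefl_of WellOrderingRel x), hs1, mul_one, hx₀ x h.symm, hw₀]
    · rw [if_pos h, if_neg (asymm_of WellOrderingRel h), one_mul, hwl]
  have hD : diag d * diag d⁻¹ = (1 : FI K X) := by
    rw [diag_mul_diag, ← diag_one]
    congr 1
    ext x
    exact mul_inv_cancel₀ (hd0 x)
  have hDτ : rho hl hs (diag d⁻¹) * rho hl hs (diag d) = 1 := by
    rw [← hinv.map_mul, hD, rho_one]
  -- With `D = diag d`, the symmetric element `D⁻¹ * w * τ D⁻¹` has unit diagonal. For its symmetric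
  -- root `z`, `z * τ z = z * z`, so `D * z` solves the problem.
  obtain ⟨z, hz, hzτ, hzz⟩ := exists_sqrt hl hs h2
    (w := diag d⁻¹ * w * rho hl hs (diag d⁻¹)) (fun x => by
      rw [mul_apply_self, diag_mul_apply, rho_apply, diag_apply_self, ← hdw x]
      have : s (d⁻¹ (l x)) = (s (d (l x)))⁻¹ := map_inv₀ hs.ringEquiv _
      rw [this, Pi.inv_apply, inv_mul_cancel_left₀ (hd0 x), mul_inv_cancel₀ (hs0 _ (hd0 _))])
    (by rw [hinv.map_mul, hinv.map_mul, hinv.involutive, hτ, mul_assoc])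
  refine ⟨diag d * z, (isUnit_diag hd0).mul hz, ?_⟩
  rw [hinv.map_mul, hzτ, mul_assoc, ← mul_assoc z, hzz, mul_assoc, hDτ, mul_one, ← mul_assoc, hD,
    one_mul]

/-! ### Comparison of `ρ` with `rho hl hs`. -/

/-- An involution inducing `l` on the poset and `s` on the field is equivalent to `ρ_l^s`. -/
theorem equivViaInner_rho (hchar : ringChar K ≠ 2)
    (hX : PosetConnected X)
    (hmult : MultAutInner K X)
    {s : K → K} (hs : IsAlgInvolution s) (hs₂ : IsSecondKind s)
    {l : X → X} (hl : IsPosetInvolution l)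
    (hfix : ∃! x : X, l x = x)
    {ρ : FI K X → FI K X} (hρ : IsAlgInvolution ρ)
    (hρX : InducesOnPoset ρ l) (hρK : InducesOnField ρ s) :
    EquivViaInner K ρ (rho hl hs) := by
  classical
  obtain ⟨x₀, hx₀, huniq⟩ := hfix
  have hτ := isAlgInvolution_rho hl hs
  set τ := rho hl hs with hτ_def
  let Φ : FI K X ≃ₐ[K] FI K X :=
    { toFun := fun f => ρ (τ f)
      invFun := fun f => τ (ρ f)
      left_inv := fun f => by change τ (ρ (ρ (τ f))) = f; rw [hρ.involutive, hτ.involutive]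
      right_inv := fun f => by change ρ (τ (τ (ρ f))) = f; rw [hτ.involutive, hρ.involutive]
      map_mul' := fun f g => by rw [hτ.map_mul, hρ.map_mul]
      map_add' := fun f g => by rw [hτ.map_add, hρ.map_add]
      commutes' := fun c => by rw [hτ_def, rho_algebraMap, hρK, hs.involutive] }
  -- The action of `ρ` on the poset enters only through the diagonal of `ρ (e K (l x))`, which
  -- conjugation does not change.
  obtain ⟨w, hw⟩ := exists_eq_innerAut (Φ := Φ) hmult fun x y => by
    obtain ⟨u, hu⟩ := hρX (l x)
    change (ρ (τ (e K x))).1 y y = _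
    rw [hτ_def, rho_e, hu, hl.involutive, innerAut_apply_self]
  have hρw : ∀ f, ρ f = w * τ f * (w⁻¹ : (FI K X)ˣ) := fun f => by
    have h : ρ (τ (τ f)) = w * τ f * (w⁻¹ : (FI K X)ˣ) := hw (τ f)
    rwa [hτ.involutive] at h
  have hτ1 : τ 1 = 1 := rho_one hl hs
  have hwτ : τ w * τ (w⁻¹ : (FI K X)ˣ) = 1 := by rw [← hτ.map_mul, Units.inv_mul, hτ1]
  have hcomm : ∀ f, τ w * (w⁻¹ : (FI K X)ˣ) * f = f * (τ w * (w⁻¹ : (FI K X)ˣ)) := fun f => by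
    have h := hρ.involutive f
    rw [hρw (ρ f), hρw f, hτ.map_mul, hτ.map_mul, hτ.involutive] at h
    conv_lhs => rw [← h]
    simp only [mul_assoc, Units.inv_mul_cancel_left]
    rw [← mul_assoc (τ w), hwτ, one_mul]
  obtain ⟨d, hd⟩ : ∃ d : K, τ w = d • (w : FI K X) := by
    have h := (Units.mul_inv_eq_iff_eq_mul w).1 (eq_algebraMap_of_forall_commute hX x₀ hcomm)
    exact ⟨_, h.trans (Algebra.smul_def _ _).symm⟩
  have hw0 : ∀ x, (w : FI K X).1 x x ≠ 0 := fun x h => by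
    have h1 := mul_apply_self (w : FI K X) (w⁻¹ : (FI K X)ˣ) x
    rw [Units.mul_inv, one_apply, if_pos rfl, h, zero_mul] at h1
    exact one_ne_zero h1
  have hdd : s d * d = 1 := by
    have h1 := hτ.involutive (w : FI K X)
    rw [hd, hτ_def, rho_smul, ← hτ_def, hd, smul_smul] at h1
    have h2 := congrArg (fun f : FI K X => f.1 x₀ x₀) h1
    exact (mul_eq_right₀ (hw0 x₀)).1 h2
  obtain ⟨b, hb0, hb⟩ := hs.exists_ne_zero_map_mul_eq hs₂ hdd
  set v : FI K X := b • (w : FI K X) with hv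
  have hvτ : τ v = v := by rw [hv, hτ_def, rho_smul, ← hτ_def, hd, smul_smul, hb]
  set k := v.1 x₀ x₀ with hk
  have hk0 : k ≠ 0 := mul_ne_zero hb0 (hw0 x₀)
  -- `τ v = v` compares the entry at `(x₀, x₀)` with the one at `(l x₀, l x₀)`, which is the same.
  have hsk : s k = k := by
    conv_rhs => rw [hk, ← hvτ]
    rw [hτ_def, rho_apply, hx₀]
  have hsk' : s k⁻¹ = k⁻¹ := by
    have : s k⁻¹ = (s k)⁻¹ := map_inv₀ hs.ringEquiv k
    rw [this, hsk]
  have h2 : (2 : K) ≠ 0 := Ring.two_ne_zero hchar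
  obtain ⟨z, ⟨z, rfl⟩, hz⟩ := exists_mul_rho_eq hl hs h2 huniq (w := k⁻¹ • v)
    (fun x => mul_ne_zero (inv_ne_zero hk0) (mul_ne_zero hb0 (hw0 x)))
    (inv_mul_cancel₀ hk0) (by rw [rho_smul, ← hτ_def, hvτ, hsk'])
  rw [← hτ_def] at hz
  have hρz : ∀ f, ρ f * (z * τ z) = z * τ z * τ f := fun f => by
    rw [hz, hv, hρw, smul_smul, mul_smul_comm, smul_mul_assoc, Units.inv_mul_cancel_right]
  refine ⟨z⁻¹, funext fun f => ?_⟩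
  change ((z⁻¹ : (FI K X)ˣ) : FI K X) * ρ f * ((z⁻¹)⁻¹ : (FI K X)ˣ) =
    τ (((z⁻¹ : (FI K X)ˣ) : FI K X) * f * ((z⁻¹)⁻¹ : (FI K X)ˣ))
  rw [inv_inv, hτ.map_mul, hτ.map_mul]
  have hzτ : τ z * τ (z⁻¹ : (FI K X)ˣ) = 1 := by rw [← hτ.map_mul, Units.inv_mul, hτ1]
  calc ((z⁻¹ : (FI K X)ˣ) : FI K X) * ρ f * z
      = (z⁻¹ : (FI K X)ˣ) * (ρ f * (z * τ z)) * τ (z⁻¹ : (FI K X)ˣ) := by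
        simp only [mul_assoc, hzτ, mul_one]
    _ = τ z * (τ f * τ (z⁻¹ : (FI K X)ˣ)) := by
        rw [hρz]
        simp only [mul_assoc, Units.inv_mul_cancel_left]

end FI

theorem theorem4p12 {K X : Type*} [Field K] [PartialOrder X]
    (hchar : ringChar K ≠ 2)
    (hX : PosetConnected X)
    (hmult : FI.MultAutInner K X)
    (s : K → K) (hs : IsAlgInvolution s) (hs₂ : IsSecondKind s)
    (l : X → X) (hl : IsPosetInvolution l)
    (hfix : ∃! x : X, l x = x)
    (ρ : FI K X → FI K X) (hρ : IsAlgInvolution ρ)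
    (hρX : FI.InducesOnPoset ρ l) (hρK : FI.InducesOnField ρ s) :
    EquivViaInner K ρ (FI.rho hl hs) := by
  exact FI.equivViaInner_rho hchar hX hmult hs hs₂ hl hfix hρ hρX hρK
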